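/- Let $R$ be an associative ring with identity (not necessarily commutative) and let $U$ be an $R$-module (all modules are unital and on one fixed side). Suppose that $U$ is uniserial, i.e. any two submodules of $U$ are comparable by inclusion, that $U$ is of type $1$, i.e. its endomorphism ring $S=\operatorname{End}_R(U)$ is local, and that $S$ contains a monomorphism $U\to U$ that is not onto. Let $\operatorname{Add}(U)$ be the class of all modules isomorphic to a direct summand of a direct sum $U^{(X)}$ of copies of $U$. An $\operatorname{Add}(U)$-cover of a module $M$ is a homomorphism $f\colon A\to M$ with $A\in\operatorname{Add}(U)$ such that every homomorphism $B\to M$ with $B\in\operatorname{Add}(U)$ factors through $f$, and such that every endomorphism $h$ of $A$ with $fh=f$ is an automorphism. Then there exists a uniserial module $V$ that has no $\operatorname{Add}(U)$-cover. Moreover, $V$ can be chosen to be the direct limit of a directed system $(U_\alpha)_{\alpha<\beta}$, with maps $f_{\alpha,\gamma}\colon U_\gamma\to U_\alpha$ $(\gamma\le\alpha<\beta)$, where $\beta$ is a nonzero limit ordinal, such that 1. $U_\alpha\cong U$ for every $\alpha<\beta$; 2. $f_{\alpha,\gamma}$ is injective and not surjective for all $\gamma<\alpha<\beta$; 3. for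 every nonzero limit ordinal $\alpha<\beta$, $U_\alpha$ (with the maps $f_{\alpha,\gamma}$) is the direct limit of the system $(U_\gamma)_{\gamma<\alpha}$. In particular, $\operatorname{Add}(U)$ is not covering (not every module has an $\operatorname{Add}(U)$-cover), and $\operatorname{Add}(U)$ is not closed under direct limits. -/

import Mathlib

universe u v w

/-- A module is uniserial if any two of its submodules are comparable by inclusion. -/
def IsUniserial (R : Type v) [Ring R] (M : Type u) [AddCommGroup M] [Module R M] : Prop :=
  ∀ N P : Submodule R M, N ≤ P ∨ P ≤ N

/-- `M` belongs to `Add(U)`: it is isomorphic to a direct summand of a direct sum `U^(X)` of copies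
of `U` (`X →₀ U` is the module of finitely supported functions from `X` to `U`). -/
def MemAdd (R : Type v) [Ring R] (U : Type u) [AddCommGroup U] [Module R U]
    (M : Type u) [AddCommGroup M] [Module R M] : Prop :=
  ∃ (X : Type u) (P Q : Submodule R (X →₀ U)), IsCompl P Q ∧ Nonempty (M ≃ₗ[R] P)

/-- `f : A → M` is an `Add(U)`-precover of `M`: `A` is in `Add(U)`, and every homomorphism to `M`
from a module in `Add(U)` factors through `f`. -/
def IsAddPrecover (R : Type v) [Ring R] (U : Type u) [AddCommGroup U] [Module R U]
    {A M : Type u} [AddCommGroup A] [Module R A] [AddCommGroup M] [Module R M]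
    (f : A →ₗ[R] M) : Prop :=
  MemAdd R U A ∧
    ∀ (B : Type u) [AddCommGroup B] [Module R B], MemAdd R U B →
      ∀ g : B →ₗ[R] M, ∃ h : B →ₗ[R] A, f ∘ₗ h = g

/-- `f : A → M` is an `Add(U)`-cover of `M`: an `Add(U)`-precover such that every endomorphism `h`
of `A` with `f ∘ h = f` is an automorphism. -/
def IsAddCover (R : Type v) [Ring R] (U : Type u) [AddCommGroup U] [Module R U]
    {A M : Type u} [AddCommGroup A] [Module R A] [AddCommGroup M] [Module R M]
    (f : A →ₗ[R] M) : Prop :=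
  IsAddPrecover R U f ∧ ∀ h : A →ₗ[R] A, f ∘ₗ h = f → Function.Bijective h

/-- `M` has an `Add(U)`-cover. -/
def HasAddCover (R : Type v) [Ring R] (U : Type u) [AddCommGroup U] [Module R U]
    (M : Type u) [AddCommGroup M] [Module R M] : Prop :=
  ∃ (A : Type u) (_ : AddCommGroup A) (_ : Module R A) (f : A →ₗ[R] M), IsAddCover R U f

/-- The class `Add(U)` is covering: every module has an `Add(U)`-cover. -/
def AddIsCovering (R : Type v) [Ring R] (U : Type u) [AddCommGroup U] [Module R U] : Prop :=
  ∀ (M : Type u) [AddCommGroup M] [Module R M], HasAddCover R U M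

open Classical in
/-- `M`, with the maps `g i : G i → M`, is a direct limit of the system `(G, f)`: the maps `g i` are
compatible with the system, and the induced map from Mathlib's direct limit to `M` is bijective. -/
def IsDirectLimit (R : Type v) [Ring R] {ι : Type w} [Preorder ι]
    {G : ι → Type u} [∀ i, AddCommGroup (G i)] [∀ i, Module R (G i)]
    (f : ∀ i j, i ≤ j → G i →ₗ[R] G j)
    {M : Type u} [AddCommGroup M] [Module R M] (g : ∀ i, G i →ₗ[R] M) : Prop :=
  ∃ hg : ∀ i j (hij : i ≤ j) (x : G i), g j (f i j hij x) = g i x,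
    Function.Bijective (Module.DirectLimit.lift R ι G f g hg)

/-- The class `Add(U)` is closed under direct limits of directed systems of modules. -/
def AddIsClosedUnderDirectLimits (R : Type v) [Ring R]
    (U : Type u) [AddCommGroup U] [Module R U] : Prop :=
  ∀ (ι : Type u) [Preorder ι] [IsDirectedOrder ι] [Nonempty ι]
    (G : ι → Type u) [∀ i, AddCommGroup (G i)] [∀ i, Module R (G i)]
    (f : ∀ i j, i ≤ j → G i →ₗ[R] G j) [DirectedSystem G (fun i j h => f i j h)]
    (M : Type u) [AddCommGroup M] [Module R M] (g : ∀ i, G i →ₗ[R] M),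
    (∀ i, MemAdd R U (G i)) → IsDirectLimit R f g → MemAdd R U M

/-- `V` is a direct limit of a continuous well-ordered system, indexed by (a well-ordered set whose
order type is) a nonzero limit ordinal, of modules isomorphic to `U`, in which the map from each
term to every later term is injective and not surjective. Continuity: each term with limit index is
the direct limit of the terms before it. -/
def IsTransfiniteLimitOfCopies (R : Type v) [Ring R] (U : Type u) [AddCommGroup U] [Module R U]
    (V : Type u) [AddCommGroup V] [Module R V] : Prop :=
  ∃ (ι : Type u) (_ : LinearOrder ι) (_ : WellFoundedLT ι) (_ : Nonempty ι) (_ : NoMaxOrder ι)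
    (G : ι → Type u) (_ : ∀ i, AddCommGroup (G i)) (_ : ∀ i, Module R (G i))
    (f : ∀ i j, i ≤ j → G i →ₗ[R] G j) (_ : DirectedSystem G (fun i j h => f i j h))
    (g : ∀ i, G i →ₗ[R] V),
    (∀ i, Nonempty (G i ≃ₗ[R] U)) ∧
    (∀ i j (hij : i < j), Function.Injective (f i j hij.le) ∧
      ¬ Function.Surjective (f i j hij.le)) ∧
    (∀ i, Order.IsSuccLimit i →
      IsDirectLimit R (ι := Set.Iio i) (G := fun j => G j.1)
        (fun j k hjk => f j.1 k.1 hjk) (fun j => f j.1 i (le_of_lt j.2))) ∧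
    IsDirectLimit R f g

/-!
The module `V` arises by iterating a non-surjective embedding `φ` of `U` into itself transfinitely,
taking direct limits at limit steps and stopping at the first module that is not isomorphic to `U`
(`exists_chain_isSuccLimit`). Such a stage exists: otherwise some copy of `U` would contain
a strictly increasing chain of submodules longer than the cardinality of `U` permits. It has a limit
index, as the successor of a copy of `U` is a copy of `U`. So `V` is a union of a chain of copies of
`U`, hence uniserial, and `V` is not isomorphic to `U`.

That `V` has no cover (`not_hasAddCover`) needs no structure theory of `Add(U)`. Suppose that
`f : A → V` is a cover. If `s : U → A` is such that `f ∘ s` is not surjective, then `f ∘ s` factors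
through a copy of `U` in `V` by a non-surjective endomorphism of `U`. Together with the locality of
`End U` and the minimality of `f` this makes `1 - b ∘ s` invertible for every `b : A → U`
(`IsAddCover.isUnit_one_sub_comp`). An element `a` of a direct summand of a direct sum of copies of
`U` is a finite sum of terms `s x (b x a)`, and Gaussian elimination removes from it all terms with
`f ∘ s x` not surjective (`exists_eq_sum_of_eliminate`). The remaining `f ∘ s x` are surjective, so
they are not injective, as `V` is not a copy of `U`. Now an embedding of `U` into `V` lifts to
`h : U → A`. For `a = h u` with `u ≠ 0`, uniseriality gives a nonzero multiple of `u` at which all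
`f (s x (b x (h _)))` vanish, although `f ∘ h` is injective.

If `V` were in `Add(U)`, its identity would be a cover; so `Add(U)` is not closed under direct limits.
-/

/-! ### Uniserial modules and local endomorphism rings -/

section Uniserial

variable {R : Type v} [Ring R] {U : Type u} [AddCommGroup U] [Module R U]

theorem IsUniserial.inf_ne_bot (hU : IsUniserial R U) {N P : Submodule R U}
    (hN : N ≠ ⊥) (hP : P ≠ ⊥) : N ⊓ P ≠ ⊥ := by
  rcases hU N P with h | h
  · rwa [inf_eq_left.2 h]
  · rwa [inf_eq_right.2 h]

theorem IsUniserial.finset_inf_ne_bot (hU : IsUniserial R U) [Nontrivial U] {ι : Type*}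
    (s : Finset ι) {K : ι → Submodule R U} (hK : ∀ i ∈ s, K i ≠ ⊥) : s.inf K ≠ ⊥ := by
  induction s using Finset.cons_induction with
  | empty => simp
  | cons i s hi ih =>
    rw [Finset.inf_cons]
    exact hU.inf_ne_bot (hK i (Finset.mem_cons_self i s))
      (ih fun j hj => hK j (Finset.mem_cons_of_mem hj))

/-- If `g` is injective, its range meets the kernel of `q` nontrivially. -/
theorem IsUniserial.ker_comp_ne_bot (hU : IsUniserial R U) [Nontrivial U]
    {V : Type*} [AddCommGroup V] [Module R V] {q : U →ₗ[R] V}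
    (hq : LinearMap.ker q ≠ ⊥) (g : U →ₗ[R] U) : LinearMap.ker (q ∘ₗ g) ≠ ⊥ := by
  by_cases hg : LinearMap.ker g = ⊥
  · have hrange : LinearMap.range g ≠ ⊥ := by
      intro h
      rw [LinearMap.range_eq_bot] at h
      rw [h, LinearMap.ker_zero] at hg
      exact top_ne_bot hg
    obtain ⟨_, ⟨⟨y, rfl⟩, hx⟩, hx0⟩ :=
      Submodule.exists_mem_ne_zero_of_ne_bot (hU.inf_ne_bot hrange hq)
    refine (Submodule.ne_bot_iff _).2 ⟨y, hx, ?_⟩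
    rintro rfl
    exact hx0 (map_zero g)
  · intro h
    exact hg (eq_bot_iff.2 (h ▸ LinearMap.ker_le_ker_comp g q))

/-- Over a local ring `S`, an element with a left inverse has a right inverse: for `c * g = 1` the
element `g * c` is idempotent, hence `0` or `1`. -/
theorem IsLocalRing.mul_eq_one_symm {S : Type*} [Ring S] (hS : IsLocalRing S) {c g : S}
    (h : c * g = 1) : g * c = 1 := by
  have hidem : g * c * (1 - g * c) = 0 := by
    rw [mul_sub, mul_one, mul_assoc g c, ← mul_assoc c g, h, one_mul, sub_self]
  rcases IsLocalRing.isUnit_or_isUnit_of_add_one (add_sub_cancel (g * c) 1) with hu | hu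
  · exact (sub_eq_zero.1 ((hu.mul_right_eq_zero).1 hidem)).symm
  · have h0 : g * c = 0 := (hu.mul_left_eq_zero).1 hidem
    have : (1 : S) = 0 := by
      calc (1 : S) = c * g * (c * g) := by rw [h, one_mul]
        _ = c * (g * c) * g := by simp only [mul_assoc]
        _ = 0 := by rw [h0, mul_zero, zero_mul]
    exact absurd this one_ne_zero

/-- In a local endomorphism ring a left multiple `m * g` of a non-surjective `g` is never a unit
(otherwise `g` would have a left inverse, hence a right inverse), so it cannot turn a non-unit into
a unit. -/
theorem isUnit_of_isUnit_add_mul (hS : IsLocalRing (Module.End R U)) {x m g : Module.End R U}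
    (hg : ¬ Function.Surjective g) (h : IsUnit (x + m * g)) : IsUnit x := by
  obtain ⟨y, hy⟩ := h
  have hsum : (↑y⁻¹ * x : Module.End R U) + ↑y⁻¹ * m * g = 1 := by
    rw [mul_assoc, ← mul_add, ← hy, Units.inv_mul]
  rcases IsLocalRing.isUnit_or_isUnit_of_add_one hsum with hu | hu
  · simpa using hu
  · obtain ⟨c, hc⟩ := hu.exists_left_inv
    have := hS.mul_eq_one_symm (c := c * (↑y⁻¹ * m)) (g := g) (by rw [mul_assoc]; exact hc)
    refine absurd (fun z => ⟨(c * (↑y⁻¹ * m)) z, ?_⟩) hg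
    simpa using LinearMap.congr_fun this z

end Uniserial

/-! ### Covers by direct summands of direct sums -/

section Cover

variable {R : Type v} [Ring R] {U : Type u} [AddCommGroup U] [Module R U]

theorem memAdd_of_equiv {M : Type u} [AddCommGroup M] [Module R M] (e : M ≃ₗ[R] U) :
    MemAdd R U M :=
  ⟨PUnit, ⊤, ⊥, isCompl_top_bot,
    ⟨e ≪≫ₗ (Finsupp.uniqueLinearEquiv R U PUnit.unit).symm ≪≫ₗ Submodule.topEquiv.symm⟩⟩

/-- Each element of a module in `Add(U)` is reproduced by a finite sum of endomorphisms factoring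
through `U`. -/
theorem MemAdd.exists_eq_sum {A : Type u} [AddCommGroup A] [Module R A] (hA : MemAdd R U A)
    (a : A) : ∃ (X : Type u) (F : Finset X) (s : X → U →ₗ[R] A) (b : X → A →ₗ[R] U),
      a = ∑ x ∈ F, s x (b x a) := by
  obtain ⟨X, P, Q, hPQ, ⟨e⟩⟩ := hA
  refine ⟨X, (e a : X →₀ U).support,
    fun x => e.symm.toLinearMap ∘ₗ P.projectionOnto Q hPQ ∘ₗ Finsupp.lsingle x,
    fun x => Finsupp.lapply x ∘ₗ P.subtype ∘ₗ e.toLinearMap, ?_⟩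
  have h : (e a : X →₀ U) = ∑ x ∈ (e a : X →₀ U).support, Finsupp.single x ((e a : X →₀ U) x) :=
    (Finsupp.sum_single (e a : X →₀ U)).symm
  have h2 := congrArg (fun y => e.symm (P.projectionOnto Q hPQ y)) h
  simp only [Submodule.projectionOnto_apply_left, e.symm_apply_apply, map_sum] at h2
  exact h2

/-- If `1 + a ∘ b` is bijective then so is `1 + b ∘ a`. -/
theorem bijective_one_add_comp {A : Type*} [AddCommGroup A] [Module R A]
    (a : U →ₗ[R] A) (b : A →ₗ[R] U)
    (h : Function.Bijective (LinearMap.id + a ∘ₗ b : A →ₗ[R] A)) :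
    Function.Bijective (LinearMap.id + b ∘ₗ a : U →ₗ[R] U) := by
  constructor
  · rw [injective_iff_map_eq_zero]
    intro x hx
    simp only [LinearMap.add_apply, LinearMap.id_apply, LinearMap.comp_apply] at hx
    have hax : a x = 0 := by
      apply (injective_iff_map_eq_zero _).1 h.1
      simp only [LinearMap.add_apply, LinearMap.id_apply, LinearMap.comp_apply]
      rw [← map_add, hx, map_zero]
    simpa [hax] using hx
  · intro y
    obtain ⟨z, hz⟩ := h.2 (a y)
    simp only [LinearMap.add_apply, LinearMap.id_apply, LinearMap.comp_apply] at hz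
    refine ⟨y - b z, ?_⟩
    simp only [LinearMap.add_apply, LinearMap.id_apply, LinearMap.comp_apply, map_sub]
    rw [← hz, map_add]
    abel

/-- Gaussian elimination: terms `s x ∘ b x` for which `1 - b x ∘ s x` is invertible can be removed
one after the other from a presentation `a = ∑ s x (b x a)`, at the cost of changing the
remaining `s x`. -/
theorem exists_eq_sum_of_eliminate {A : Type*} [AddCommGroup A] [Module R A]
    (p : (U →ₗ[R] A) → Prop)
    (hp : ∀ (s : U →ₗ[R] A) (b : A →ₗ[R] U), ¬ p s → IsUnit (1 - b ∘ₗ s : Module.End R U))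
    {X : Type*} (b : X → A →ₗ[R] U) (a : A) (F : Finset X) (s : X → U →ₗ[R] A)
    (h : a = ∑ x ∈ F, s x (b x a)) :
    ∃ (F' : Finset X) (s' : X → U →ₗ[R] A),
      (∀ x ∈ F', p (s' x)) ∧ a = ∑ x ∈ F', s' x (b x a) := by
  classical
  induction F using Finset.strongInduction generalizing s with
  | H F ih =>
    by_cases hF : ∀ x ∈ F, p (s x)
    · exact ⟨F, s, hF, h⟩
    · push Not at hF
      obtain ⟨z, hz, hps⟩ := hF
      obtain ⟨d, hd⟩ := (hp (s z) (b z) hps).exists_left_inv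
      -- Solve the relation for the coordinate `b z a` in terms of the other coordinates.
      have hbz : b z a = d (∑ x ∈ F.erase z, b z (s x (b x a))) := by
        have h1 : b z a - b z (s z (b z a)) = ∑ x ∈ F.erase z, b z (s x (b x a)) := by
          rw [sub_eq_iff_eq_add, ← map_sum, ← map_add, Finset.sum_erase_add _ _ hz, ← h]
        rw [← h1]
        simpa using (LinearMap.congr_fun hd (b z a)).symm
      refine ih (F.erase z) (Finset.erase_ssubset hz)
        (fun x => s x + s z ∘ₗ d ∘ₗ b z ∘ₗ s x) ?_
      simp only [LinearMap.add_apply, LinearMap.comp_apply, Finset.sum_add_distrib]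
      rw [← map_sum (s z), ← map_sum d, ← hbz, Finset.sum_erase_add _ _ hz]
      exact h

/-- Let `f : A → V` be a cover and `f ∘ s = i ∘ g` with `g` not surjective. Lifting `i` to
`h : U → A`, the endomorphism `k = 1 + (h ∘ g - s) ∘ b` of `A` satisfies `f ∘ k = f`, so it is bijective,
and then so is `1 + b ∘ (h ∘ g - s)`. Since `b ∘ h ∘ g` is a non-unit, `1 - b ∘ s` is a unit. -/
theorem IsAddCover.isUnit_one_sub_comp (hS : IsLocalRing (Module.End R U))
    {A V : Type u} [AddCommGroup A] [Module R A] [AddCommGroup V] [Module R V]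
    (hfac : ∀ q : U →ₗ[R] V, ¬ Function.Surjective q →
      ∃ (i : U →ₗ[R] V) (g : U →ₗ[R] U), ¬ Function.Surjective g ∧ q = i ∘ₗ g)
    {f : A →ₗ[R] V} (hf : IsAddCover R U f) (s : U →ₗ[R] A) (b : A →ₗ[R] U)
    (hs : ¬ Function.Surjective (f ∘ₗ s)) : IsUnit (1 - b ∘ₗ s : Module.End R U) := by
  obtain ⟨i, g, hg, hig⟩ := hfac _ hs
  obtain ⟨h, hh⟩ := hf.1.2 U (memAdd_of_equiv (LinearEquiv.refl R U)) i
  have hk := hf.2 (LinearMap.id + (h ∘ₗ g - s) ∘ₗ b) (by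
    rw [LinearMap.comp_add, ← LinearMap.comp_assoc, LinearMap.comp_sub, ← LinearMap.comp_assoc,
      hh, ← hig, sub_self, LinearMap.zero_comp, add_zero, LinearMap.comp_id])
  refine isUnit_of_isUnit_add_mul hS (m := b ∘ₗ h) hg ?_
  rw [Module.End.isUnit_iff]
  convert bijective_one_add_comp _ _ hk using 2
  ext x
  simp [sub_add_eq_add_sub, add_sub_assoc]

/-- If `f : A → V` were a cover, every `a : A` would be a sum of terms `s x (b x a)` with all
`f ∘ s x` surjective, hence not injective. For `a` in a copy of `U` on which `f` is injective,
uniseriality yields a nonzero multiple of `a` at which `f` of every term vanishes. -/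
theorem not_hasAddCover (hU : IsUniserial R U) (hS : IsLocalRing (Module.End R U))
    {V : Type u} [AddCommGroup V] [Module R V] (hVU : ¬ Nonempty (V ≃ₗ[R] U))
    (hfac : ∀ q : U →ₗ[R] V, ¬ Function.Surjective q →
      ∃ (i : U →ₗ[R] V) (g : U →ₗ[R] U), ¬ Function.Surjective g ∧ q = i ∘ₗ g)
    (hinj : ∃ i : U →ₗ[R] V, Function.Injective i) : ¬ HasAddCover R U V := by
  rintro ⟨A, _, _, f, hf⟩
  have : Nontrivial U := by
    by_contra hU0
    rw [not_nontrivial_iff_subsingleton] at hU0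
    exact zero_ne_one (α := Module.End R U) (Subsingleton.elim _ _)
  obtain ⟨i, hi⟩ := hinj
  obtain ⟨h, hh⟩ := hf.1.2 U (memAdd_of_equiv (LinearEquiv.refl R U)) i
  obtain ⟨u, hu⟩ := exists_ne (0 : U)
  obtain ⟨X, F, s, b, ha⟩ := hf.1.1.exists_eq_sum (h u)
  obtain ⟨F, s, hs, ha⟩ := exists_eq_sum_of_eliminate
    (fun s => Function.Surjective (f ∘ₗ s))
    (fun s b hs => hf.isUnit_one_sub_comp hS hfac s b hs) b _ F s ha
  have hker : ∀ x ∈ F, LinearMap.ker ((f ∘ₗ s x) ∘ₗ (b x ∘ₗ h)) ≠ ⊥ := fun x hx =>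
    hU.ker_comp_ne_bot (fun hk => hVU
      ⟨(LinearEquiv.ofBijective _ ⟨LinearMap.ker_eq_bot.1 hk, hs x hx⟩).symm⟩) _
  -- A nonzero multiple of `u` on which all terms of the sum vanish.
  obtain ⟨y, ⟨hyu, hy⟩, hy0⟩ := Submodule.exists_mem_ne_zero_of_ne_bot
    (hU.inf_ne_bot (N := Submodule.span R {u}) (by simpa using hu)
      (hU.finset_inf_ne_bot F hker))
  obtain ⟨r, rfl⟩ := Submodule.mem_span_singleton.1 hyu
  refine hy0 (hi ?_)
  have hy' : ∀ x ∈ F, f (s x (b x (h (r • u)))) = 0 := fun x hx =>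
    (Submodule.mem_finsetInf.1 hy) x hx
  rw [map_zero, ← hh, LinearMap.comp_apply, map_smul, ha, Finset.smul_sum, map_sum]
  exact Finset.sum_eq_zero fun x hx => by simpa using hy' x hx

/-- The identity of a module in `Add(U)` is a cover. -/
theorem MemAdd.hasAddCover {V : Type u} [AddCommGroup V] [Module R V] (hV : MemAdd R U V) :
    HasAddCover R U V := by
  refine ⟨V, _, _, LinearMap.id, ⟨hV, fun B _ _ _ g => ⟨g, rfl⟩⟩, fun h hh => ?_⟩
  obtain rfl : h = LinearMap.id := hh
  exact Function.bijective_id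

end Cover

/-! ### Continuous chains of monomorphisms -/

section Chain

open CategoryTheory CategoryTheory.Limits

variable {R : Type v} [Ring R]

theorem isDirectLimit_of_injective {ι : Type w} [Preorder ι] [IsDirectedOrder ι]
    {G : ι → Type u} [∀ i, AddCommGroup (G i)] [∀ i, Module R (G i)]
    {f : ∀ i j, i ≤ j → G i →ₗ[R] G j}
    {M : Type u} [AddCommGroup M] [Module R M] {g : ∀ i, G i →ₗ[R] M}
    (hg : ∀ i j (hij : i ≤ j) (x : G i), g j (f i j hij x) = g i x)
    (hinj : ∀ i, Function.Injective (g i)) (hsurj : ∀ z, ∃ i x, g i x = z) :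
    IsDirectLimit R f g := by
  classical
  refine ⟨hg, Module.DirectLimit.lift_injective _ _ hinj, fun z => ?_⟩
  obtain ⟨i, x, rfl⟩ := hsurj z
  exact ⟨Module.DirectLimit.of R ι G f i x, Module.DirectLimit.lift_of _ _ _⟩

section Colimit

variable {J : Type u} [LinearOrder J] {F : J ⥤ ModuleCat.{u} R} {c : Cocone F}

theorem map_map_homOfLE (F : J ⥤ ModuleCat.{u} R) {i j k : J} (hij : i ≤ j) (hjk : j ≤ k)
    (x : F.obj i) : (F.map (homOfLE hjk)).hom ((F.map (homOfLE hij)).hom x) =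
      (F.map (homOfLE (hij.trans hjk))).hom x := by
  rw [← homOfLE_comp hij hjk, F.map_comp]
  rfl

theorem directedSystem_map (F : J ⥤ ModuleCat.{u} R) :
    DirectedSystem (fun j => F.obj j) (fun _ _ h => (F.map (homOfLE h)).hom) where
  map_self i x := by
    simp
  map_map _ _ _ hij hjk x := map_map_homOfLE F hij hjk x

open Classical in
/-- The comparison map from a colimit in the category of modules to the direct limit constructed
as a quotient of a direct sum. -/
theorem exists_toDirectLimit (hc : IsColimit c) :
    ∃ d : c.pt →ₗ[R] Module.DirectLimit (fun j => F.obj j)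
        (fun _ _ h => (F.map (homOfLE h)).hom),
      ∀ j x, d ((c.ι.app j).hom x) = Module.DirectLimit.of R J _ _ j x := by
  let c' : Cocone F :=
    { pt := ModuleCat.of R (Module.DirectLimit (fun j => F.obj j)
        (fun _ _ h => (F.map (homOfLE h)).hom))
      ι :=
        { app := fun j => ModuleCat.ofHom (Module.DirectLimit.of R J (fun j => F.obj j)
            (fun _ _ h => (F.map (homOfLE h)).hom) j)
          naturality := fun i j h => by
            ext x
            exact Module.DirectLimit.of_f (f := fun _ _ h => (F.map (homOfLE h)).hom)
              (hij := leOfHom h) (x := x) } }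
  refine ⟨(hc.desc c').hom, fun j x => ?_⟩
  exact LinearMap.congr_fun (congrArg ModuleCat.Hom.hom (hc.fac c' j)) x

theorem exists_rep_of_isColimit [Nonempty J] (hc : IsColimit c) (z : c.pt) :
    ∃ j x, (c.ι.app j).hom x = z := by
  classical
  obtain ⟨d, hd⟩ := exists_toDirectLimit hc
  let l := Module.DirectLimit.lift (P := c.pt) R J (fun j => F.obj j) (fun _ _ h => (F.map (homOfLE h)).hom)
    (fun j => (c.ι.app j).hom) (fun i j hij x => by
      rw [← c.w (homOfLE hij)]
      rfl)
  have hl : ModuleCat.ofHom (l ∘ₗ d) = 𝟙 c.pt := hc.hom_ext fun j => by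
    ext x
    simp [l, hd]
  obtain ⟨j, x, hx⟩ := Module.DirectLimit.exists_of (d z)
  refine ⟨j, x, ?_⟩
  have : l (d z) = z := LinearMap.congr_fun (congrArg ModuleCat.Hom.hom hl) z
  rw [← this, ← hx, Module.DirectLimit.lift_of]

theorem exists_map_eq_zero_of_isColimit [Nonempty J] (hc : IsColimit c) {j : J} {x : F.obj j}
    (hx : (c.ι.app j).hom x = 0) : ∃ (k : J) (h : j ≤ k), (F.map (homOfLE h)).hom x = 0 := by
  classical
  have := directedSystem_map F
  obtain ⟨d, hd⟩ := exists_toDirectLimit hc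
  refine Module.DirectLimit.of.zero_exact (f := fun _ _ h => (F.map (homOfLE h)).hom) ?_
  rw [← hd, hx, map_zero]

end Colimit

/-- The transfinite iteration of the embedding `φ` of `U` into itself, as long as the modules
reached are copies of `U`; all other modules are left unchanged by a step. -/
theorem exists_continuous_chain {U : Type u} [AddCommGroup U] [Module R U]
    {φ : U →ₗ[R] U} (hφ : Function.Injective φ) (hφ' : ¬ Function.Surjective φ)
    (J : Type u) [LinearOrder J] [OrderBot J] [SuccOrder J] [WellFoundedLT J] :
    ∃ F : J ⥤ ModuleCat.{u} R, F.IsWellOrderContinuous ∧ Nonempty (F.obj ⊥ ≃ₗ[R] U) ∧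
      ∀ j, ¬ IsMax j → Function.Injective (F.map (homOfLE (Order.le_succ j))).hom ∧
        (Nonempty (F.obj j ≃ₗ[R] U) → Nonempty (F.obj (Order.succ j) ≃ₗ[R] U) ∧
          ¬ Function.Surjective (F.map (homOfLE (Order.le_succ j))).hom) := by
  have hstep : ∀ X : ModuleCat.{u} R, ∃ (Y : ModuleCat.{u} R) (t : X ⟶ Y),
      Function.Injective t.hom ∧
        (Nonempty (X ≃ₗ[R] U) → Nonempty (Y ≃ₗ[R] U) ∧ ¬ Function.Surjective t.hom) := by
    intro X
    by_cases hX : Nonempty (X ≃ₗ[R] U)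
    · obtain ⟨e⟩ := hX
      exact ⟨ModuleCat.of R U, ModuleCat.ofHom (φ ∘ₗ e.toLinearMap), hφ.comp e.injective,
        fun _ => ⟨⟨LinearEquiv.refl R U⟩, fun h => hφ' (Function.Surjective.of_comp h)⟩⟩
    · exact ⟨X, 𝟙 X, Function.injective_id, fun h => absurd h hX⟩
  choose Y t ht ht' using hstep
  let Φ : SmallObject.SuccStruct (ModuleCat.{u} R) := ⟨ModuleCat.of R U, Y, t⟩
  refine ⟨Φ.iterationFunctor J, inferInstance, ⟨(Φ.iterationFunctorObjBotIso J).toLinearEquiv⟩,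
    fun j hj => ?_⟩
  let e := (Φ.iterationFunctorObjSuccIso j hj).toLinearEquiv
  have hmap : ((Φ.iterationFunctor J).map (homOfLE (Order.le_succ j))).hom =
      e.symm.toLinearMap ∘ₗ (t ((Φ.iterationFunctor J).obj j)).hom := by
    rw [Φ.iterationFunctor_map_succ j hj]
    rfl
  rw [hmap]
  refine ⟨e.symm.injective.comp (ht _), fun hU => ⟨?_, fun h => (ht' _ hU).2 ?_⟩⟩
  · obtain ⟨e'⟩ := (ht' _ hU).1
    exact ⟨e ≪≫ₗ e'⟩
  · exact (EquivLike.comp_surjective _ e.symm).1 h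

section Continuous

variable {J : Type u} [LinearOrder J] {F : J ⥤ ModuleCat.{u} R} [F.IsWellOrderContinuous]

theorem exists_rep_of_isSuccLimit {k : J} (hk : Order.IsSuccLimit k) (z : F.obj k) :
    ∃ (j : J) (h : j < k) (x : F.obj j), (F.map (homOfLE h.le)).hom x = z := by
  have : Nonempty (Set.Iio k) := hk.nonempty_Iio.to_subtype
  obtain ⟨⟨j, hj⟩, x, hx⟩ := exists_rep_of_isColimit (F.isColimitOfIsWellOrderContinuous k hk) z
  exact ⟨j, hj, x, hx⟩

/-- At a limit index `k`, an element killed on the way to `k` is already killed before `k`, because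
`F.obj k` is the direct limit of the earlier terms. -/
theorem injective_map_of_injective_succ [SuccOrder J] [WellFoundedLT J]
    (hF : ∀ j, ¬ IsMax j → Function.Injective (F.map (homOfLE (Order.le_succ j))).hom)
    {j k : J} (hjk : j ≤ k) : Function.Injective (F.map (homOfLE hjk)).hom := by
  have hid : ∀ k : J, Function.Injective (F.map (homOfLE (le_refl k))).hom := fun k => by
    have : homOfLE (le_refl k) = 𝟙 k := rfl
    rw [this, F.map_id]
    exact Function.injective_id
  induction k using SuccOrder.limitRecOn generalizing j with
  | isMin k hk =>
    obtain rfl := hk.eq_of_le hjk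
    exact hid _
  | succ k hk ih =>
    rcases hjk.eq_or_lt with rfl | h
    · exact hid _
    · have h' := Order.le_of_lt_succ h
      intro x y hxy
      rw [← map_map_homOfLE F h' (Order.le_succ k), ← map_map_homOfLE F h' (Order.le_succ k)]
        at hxy
      exact ih h' (hF k hk hxy)
  | isSuccLimit k hk ih =>
    rcases hjk.eq_or_lt with rfl | h
    · exact hid _
    · have : Nonempty (Set.Iio k) := ⟨⟨j, h⟩⟩
      rw [injective_iff_map_eq_zero]
      intro x hx
      obtain ⟨⟨l, hl⟩, hjl, hx'⟩ := exists_map_eq_zero_of_isColimit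
        (F.isColimitOfIsWellOrderContinuous k hk) (j := ⟨j, h⟩) (x := x) hx
      exact (injective_iff_map_eq_zero _).1 (ih l hl hjl) x hx'

end Continuous

/-- A chain that continues for long enough leaves the isomorphism class of `U`, since a strictly
increasing chain of submodules of `U` is not longer than the cardinality of `U` allows. The first
term outside this class has a limit index. -/
theorem exists_chain_isSuccLimit {U : Type u} [AddCommGroup U] [Module R U]
    {φ : U →ₗ[R] U} (hφ : Function.Injective φ) (hφ' : ¬ Function.Surjective φ) :
    ∃ (J : Type u) (_ : LinearOrder J) (_ : SuccOrder J) (_ : WellFoundedLT J)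
      (F : J ⥤ ModuleCat.{u} R) (_ : F.IsWellOrderContinuous) (k : J),
      Order.IsSuccLimit k ∧ ¬ Nonempty (F.obj k ≃ₗ[R] U) ∧
      (∀ j < k, Nonempty (F.obj j ≃ₗ[R] U)) ∧
      (∀ i j (h : i ≤ j), Function.Injective (F.map (homOfLE h)).hom) ∧
      ∀ i j (h : i < j), j ≤ k → ¬ Function.Surjective (F.map (homOfLE h.le)).hom := by
  obtain ⟨α, hα⟩ : ∃ α : Type u, ∀ f : α → U, ¬ Function.Injective f :=
    ⟨Set U, Function.cantor_injective⟩
  have hne : Nonempty α := by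
    by_contra h
    rw [not_nonempty_iff] at h
    exact hα (fun _ => 0) (Function.injective_of_subsingleton _)
  obtain ⟨_, _⟩ := exists_wellFoundedLT α
  let _ : OrderBot (WithTop α) := WellFoundedLT.toOrderBot _
  let _ : SuccOrder (WithTop α) := SuccOrder.ofLinearWellFoundedLT _
  obtain ⟨F, hF, hbot, hsucc⟩ := exists_continuous_chain hφ hφ' (WithTop α)
  have hinj : ∀ i j (h : i ≤ j), Function.Injective (F.map (homOfLE h)).hom := fun i j h =>
    injective_map_of_injective_succ (fun j hj => (hsucc j hj).1) h
  have hout : ∃ k, ¬ Nonempty (F.obj k ≃ₗ[R] U) := by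
    by_contra! hall
    -- Otherwise an element new at each step `a + 1` embeds `α` into the top term, a copy of `U`.
    have hmax : ∀ a : α, ¬ IsMax (a : WithTop α) := fun a => not_isMax_of_lt (WithTop.coe_lt_top a)
    have hnew : ∀ a : α, ∃ x, ∀ y,
        (F.map (homOfLE (Order.le_succ (a : WithTop α)))).hom y ≠ x := fun a => by
      have := ((hsucc a (hmax a)).2 (hall a)).2
      simpa [Function.Surjective] using this
    choose x hx using hnew
    obtain ⟨e⟩ := hall ⊤
    have key : ∀ a b : α, a < b → (F.map (homOfLE (le_top : Order.succ (a : WithTop α) ≤ ⊤))).hom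
        (x a) ≠ (F.map (homOfLE (le_top : Order.succ (b : WithTop α) ≤ ⊤))).hom (x b) := by
      intro a b hab h
      have hab' : Order.succ (a : WithTop α) ≤ b := Order.succ_le_of_lt (WithTop.coe_lt_coe.2 hab)
      rw [← map_map_homOfLE F (hab'.trans (Order.le_succ _)) le_top] at h
      have := hinj _ _ _ h
      rw [← map_map_homOfLE F hab' (Order.le_succ _)] at this
      exact hx b _ this
    refine hα (fun a => e ((F.map (homOfLE le_top)).hom (x a))) fun a b hab => ?_
    have hab' := e.injective hab
    rcases lt_trichotomy a b with h | h | h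
    · exact absurd hab' (key a b h)
    · exact h
    · exact absurd hab'.symm (key b a h)
  obtain ⟨k, hk, hmin⟩ := WellFounded.has_min (wellFounded_lt (α := WithTop α))
    {k | ¬ Nonempty (F.obj k ≃ₗ[R] U)} hout
  have hlt : ∀ j < k, Nonempty (F.obj j ≃ₗ[R] U) := fun j hj => by
    by_contra h
    exact hmin j h hj
  have hlim : Order.IsSuccLimit k := by
    refine ⟨fun h => ?_, ?_⟩
    · rw [h.eq_bot] at hk
      exact hk hbot
    · intro j hj
      refine hk (hj.succ_eq ▸ ((hsucc j (not_isMax_of_lt hj.lt)).2 (hlt j hj.lt)).1)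
  refine ⟨WithTop α, inferInstance, inferInstance, inferInstance, F, hF, k, hlim, hk, hlt, hinj, fun i j hij hjk h => ?_⟩
  have hi := not_isMax_of_lt hij
  refine ((hsucc i hi).2 (hlt i (hij.trans_le hjk))).2 fun y => ?_
  obtain ⟨x, hx⟩ := h ((F.map (homOfLE (Order.succ_le_of_lt hij))).hom y)
  refine ⟨x, hinj _ _ (Order.succ_le_of_lt hij) ?_⟩
  rw [map_map_homOfLE, hx]

end Chain

/-! ### The limit of a chain of copies of a uniserial module -/

section Limit

variable {R : Type v} [Ring R]

theorem IsUniserial.of_equiv {M N : Type*} [AddCommGroup M] [Module R M] [AddCommGroup N]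
    [Module R N] (hN : IsUniserial R N) (e : M ≃ₗ[R] N) : IsUniserial R M := fun P Q => by
  have := hN (P.map e.toLinearMap) (Q.map e.toLinearMap)
  rwa [Submodule.map_le_map_iff_of_injective e.injective,
    Submodule.map_le_map_iff_of_injective e.injective] at this

theorem isUniserial_of_directed {V : Type u} [AddCommGroup V] [Module R V] {ι : Type*}
    [Preorder ι] [IsDirectedOrder ι]
    {G : ι → Type u} [∀ i, AddCommGroup (G i)] [∀ i, Module R (G i)]
    {f : ∀ i j, i ≤ j → G i →ₗ[R] G j} {g : ∀ i, G i →ₗ[R] V}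
    (hg : ∀ i j (hij : i ≤ j) (x : G i), g j (f i j hij x) = g i x)
    (hsurj : ∀ z, ∃ i x, g i x = z) (hG : ∀ i, IsUniserial R (G i)) : IsUniserial R V := by
  intro N P
  by_contra! h
  obtain ⟨n, hn, hnP⟩ := SetLike.not_le_iff_exists.1 h.1
  obtain ⟨p, hp, hpN⟩ := SetLike.not_le_iff_exists.1 h.2
  obtain ⟨i, x, rfl⟩ := hsurj n
  obtain ⟨j, y, rfl⟩ := hsurj p
  obtain ⟨k, hik, hjk⟩ := exists_ge_ge i j
  rw [← hg i k hik] at hn hnP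
  rw [← hg j k hjk] at hp hpN
  rcases hG k (N.comap (g k)) (P.comap (g k)) with hle | hle
  · exact hnP (hle hn)
  · exact hpN (hle hp)

/-- A non-surjective map into a uniserial union of copies of `U` does not reach some element,
hence lies properly inside one of the copies. -/
theorem exists_factor_of_not_surjective {U V : Type u} [AddCommGroup U] [Module R U]
    [AddCommGroup V] [Module R V] (hV : IsUniserial R V)
    (hsurj : ∀ z : V, ∃ i : U →ₗ[R] V, Function.Injective i ∧ z ∈ LinearMap.range i)
    (q : U →ₗ[R] V) (hq : ¬ Function.Surjective q) :
    ∃ (i : U →ₗ[R] V) (g : U →ₗ[R] U), ¬ Function.Surjective g ∧ q = i ∘ₗ g := by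
  simp only [Function.Surjective, not_forall] at hq
  obtain ⟨z, hz⟩ := hq
  obtain ⟨i, hi, hzi⟩ := hsurj z
  have hle : LinearMap.range q ≤ LinearMap.range i :=
    (hV _ _).resolve_right fun h => hz (h hzi)
  have hmem : ∀ x, q x ∈ LinearMap.range i := fun x => hle (LinearMap.mem_range_self q x)
  let g : U →ₗ[R] U := (LinearEquiv.ofInjective i hi).symm.toLinearMap ∘ₗ
    q.codRestrict (LinearMap.range i) hmem
  have hcomp : ∀ x, i (g x) = q x := fun x =>
    congrArg Subtype.val ((LinearEquiv.ofInjective i hi).apply_symm_apply ⟨q x, hmem x⟩)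
  refine ⟨i, g, fun hg => ?_, LinearMap.ext fun x => (hcomp x).symm⟩
  obtain ⟨y, rfl⟩ := hzi
  obtain ⟨x, rfl⟩ := hg y
  exact hz ⟨x, (hcomp x).symm⟩

end Limit

open CategoryTheory in
theorem theorem3p4 (R : Type v) [Ring R] (U : Type u) [AddCommGroup U] [Module R U]
    (hU : IsUniserial R U) (hS : IsLocalRing (Module.End R U))
    (hmono : ∃ φ : Module.End R U, Function.Injective φ ∧ ¬ Function.Surjective φ) :
    (∃ (V : Type u) (_ : AddCommGroup V) (_ : Module R V),
      IsUniserial R V ∧ IsTransfiniteLimitOfCopies R U V ∧ ¬ HasAddCover R U V) ∧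
    ¬ AddIsCovering R U ∧ ¬ AddIsClosedUnderDirectLimits R U := by
  obtain ⟨φ, hφ, hφ'⟩ := hmono
  obtain ⟨J, _, _, _, F, _, k, hk, hkU, hcopy, hinj, hnsurj⟩ :=
    exists_chain_isSuccLimit hφ hφ'
  let G : Set.Iio k → Type u := fun i => F.obj i.1
  let f : ∀ i j : Set.Iio k, i ≤ j → G i →ₗ[R] G j :=
    fun i j h => (F.map (homOfLE (show i.1 ≤ j.1 from h))).hom
  let g : ∀ i : Set.Iio k, G i →ₗ[R] F.obj k := fun i => (F.map (homOfLE (le_of_lt i.2))).hom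
  have hG : ∀ i, Nonempty (G i ≃ₗ[R] U) := fun i => hcopy i.1 i.2
  have hg : ∀ i j (hij : i ≤ j) (x : G i), g j (f i j hij x) = g i x :=
    fun i j hij x => map_map_homOfLE F _ _ x
  have hsurj : ∀ z, ∃ i x, g i x = z := fun z => by
    obtain ⟨j, hj, x, hx⟩ := exists_rep_of_isSuccLimit hk z
    exact ⟨⟨j, hj⟩, x, hx⟩
  have hne : Nonempty (Set.Iio k) := hk.nonempty_Iio.to_subtype
  have hf : DirectedSystem G (fun i j h => f i j h) :=
    { map_self := fun i x => (directedSystem_map F).map_self (i := i.1) x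
      map_map := fun i j l hij hjl x => map_map_homOfLE F _ _ x }
  have hlim : IsDirectLimit R f g := isDirectLimit_of_injective hg (fun i => hinj _ _ _) hsurj
  have hV : IsUniserial R (F.obj k) := isUniserial_of_directed hg hsurj fun i =>
    hU.of_equiv (hG i).some
  have hcover : ¬ HasAddCover R U (F.obj k) := by
    have hrep : ∀ z : F.obj k, ∃ i : U →ₗ[R] F.obj k,
        Function.Injective i ∧ z ∈ LinearMap.range i := fun z => by
      obtain ⟨i, x, rfl⟩ := hsurj z
      obtain ⟨e⟩ := hG i
      exact ⟨g i ∘ₗ e.symm.toLinearMap, (hinj _ _ _).comp e.symm.injective, e x, by simp⟩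
    obtain ⟨i, hi, -⟩ := hrep 0
    exact not_hasAddCover hU hS hkU (exists_factor_of_not_surjective hV hrep) ⟨i, hi⟩
  have htrans : IsTransfiniteLimitOfCopies R U (F.obj k) := by
    refine ⟨Set.Iio k, inferInstance, inferInstance, hne, ?_, G, inferInstance, inferInstance,
      f, hf, g, hG, fun i j hij => ⟨hinj _ _ _, hnsurj _ _ hij (le_of_lt j.2)⟩, fun i hi => ?_,
      hlim⟩
    · exact ⟨fun i => ⟨⟨Order.succ i.1, hk.succ_lt i.2⟩,
        Order.lt_succ_of_not_isMax (not_isMax_of_lt i.2)⟩⟩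
    · have hi' : Order.IsSuccLimit i.1 := (Set.principalSegIio k).map_isSuccLimit hi
      refine isDirectLimit_of_injective (fun j l hjl x => map_map_homOfLE F _ _ x)
        (fun j => hinj _ _ _) fun z => ?_
      obtain ⟨j, hj, x, hx⟩ := exists_rep_of_isSuccLimit hi' z
      exact ⟨⟨⟨j, hj.trans i.2⟩, hj⟩, x, hx⟩
  refine ⟨⟨F.obj k, inferInstance, inferInstance, hV, htrans, hcover⟩,
    fun h => hcover (h _), fun h => hcover ?_⟩
  exact (h (Set.Iio k) G f (F.obj k) g (fun i => memAdd_of_equiv (hG i).some) hlim).hasAddCover
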